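/- Conventions. "Compact" means quasi-compact and Hausdorff; a topological space is locally compact if every point has a compact neighbourhood (so it need not be Hausdorff). A topological groupoid $G$ with unit space $X$ has a topology for which the unit map, inverse, product, range map $r$ and source map $s$ are continuous, $r$ and $s$ being moreover open onto $X$. Let $\mathbb K$ be $\mathbb R$ or $\mathbb C$. A Hilbert bundle over $X$ is a continuous open surjection $\pi:E\to X$ whose fibres $E_x=\pi^{-1}(x)$ are Hilbert spaces over $\mathbb K$, such that $u\mapsto\|u\|$ is continuous on $E$, addition is continuous on $\{(u,v)\in E\times E:\pi(u)=\pi(v)\}$, each $u\mapsto\lambda u$ ($\lambda\in\mathbb K$) is continuous on $E$, and $u_i\to 0_x$ in $E$ for every $x\in X$ and every net $(u_i)$ in $E$ with $\|u_i\|\to 0$ and $\pi(u_i)\to x$. A $G$-Hilbert bundle is a Hilbert bundle over $X$ with an action of $G$ by linear isometries $L(\gamma):E_{s(\gamma)}\to E_{r(\gamma)}$ such that $(\gamma,u)\mapsto L(\gamma)u$ is continuous from $\{(\gamma,u)\in G\times E:s(\gamma)=\pi(u)\}$ to $E$. A continuous cocycle is a continuous map $c:G\to E$ with $c(\gamma)\in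 E_{r(\gamma)}$ for all $\gamma\in G$ and $c(\gamma\gamma')=c(\gamma)+L(\gamma)c(\gamma')$ for all composable $(\gamma,\gamma')$; it defines the affine isometric action $\gamma u=L(\gamma)u+c(\gamma)$ for $s(\gamma)=\pi(u)$. A subset $A\subset E$ is invariant if $\gamma u\in A$ whenever $u\in A$ and $s(\gamma)=\pi(u)$; it is bounded if the norm is bounded on $A$; it is fiberwise convex if each $A\cap E_x$ is convex. If $X$ is locally compact, the weak topology of $E$ is the topology in which a fundamental system of neighbourhoods of $u_0\in E_{x_0}$ is given by the sets $$\{u\in E:\ \pi(u)\in V,\ |(f_i(\pi(u))\,|\,u)-(f_i(x_0)\,|\,u_0)|<\varepsilon\ \text{ for } i=1,\dots,n\},$$ where $V$ is a compact neighbourhood of $x_0$, $f_1,\dots,f_n:V\to E$ are continuous sections, and $\varepsilon>0$. For a bounded subset $A\subset E$, the convex hull $\mathrm{conv}(A)$ is the smallest fiberwise convex and weakly closed subset of $E$ containing $A$. Proposition. Let $G$ be a locally compact topological groupoid with locally compact unit space $X$, let $E$ be a $G$-Hilbert bundle, and consider the affine isometric action of $G$ on $E$ defined by a continuous cocycle $c$.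 Let $A$ be a bounded subset of $E$. If $A$ is invariant, then its convex hull $\mathrm{conv}(A)$ is also invariant. -/

import Mathlib

open CategoryTheory Bundle Topology Set

universe u v w

/-- Every point has a compact neighbourhood, where compact means quasi-compact *and* Hausdorff.
The whole space need not be Hausdorff. -/
class LocallyCompactHausdorff (X : Type*) [TopologicalSpace X] : Prop where
  exists_nhd : ∀ x : X, ∃ K ∈ 𝓝 x, IsCompact K ∧ T2Space K

section Groupoid

variable (X : Type u) [Groupoid.{v} X]

/-- The space of all arrows of a groupoid with unit space (set of objects) `X`.
An arrow `γ : x ⟶ y` has source `s(γ) = x` and range `r(γ) = y`. -/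
abbrev ArrowSpace : Type (max u v) := Quiver.Total X

/-- The composable pairs `x ⟶ y ⟶ z`, i.e. the set of `(γ', γ)` with `s(γ') = r(γ)`,
where `γ = fst`, `γ' = snd`. -/
structure ComposablePair where
  {x y z : X}
  fst : x ⟶ y
  snd : y ⟶ z

variable {X}

def sourceMap (g : ArrowSpace X) : X := g.left

def rangeMap (g : ArrowSpace X) : X := g.right

/-- The product `γ'γ` of a composable pair. -/
def ComposablePair.comp (p : ComposablePair X) : ArrowSpace X := ⟨p.x, p.z, p.fst ≫ p.snd⟩

variable [TopologicalSpace (ArrowSpace X)]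

/-- The composable pairs carry the subspace topology of `G × G`. -/
instance : TopologicalSpace (ComposablePair X) :=
  TopologicalSpace.induced
    (fun p => ((⟨p.x, p.y, p.fst⟩ : ArrowSpace X), (⟨p.y, p.z, p.snd⟩ : ArrowSpace X)))
    inferInstance

variable (X)

/-- A topological groupoid with unit space `X`, with open range and source maps. Continuity of
the unit map and of the source map makes `X` a topological subspace of the space of arrows. -/
class IsTopologicalGroupoid [TopologicalSpace X] : Prop where
  continuous_source : Continuous (sourceMap : ArrowSpace X → X)
  continuous_range : Continuous (rangeMap : ArrowSpace X → X)
  continuous_unit : Continuous (fun x : X => (⟨x, x, 𝟙 x⟩ : ArrowSpace X))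
  continuous_inv :
    Continuous (fun g : ArrowSpace X => (⟨g.right, g.left, Groupoid.inv g.hom⟩ : ArrowSpace X))
  continuous_comp : Continuous (ComposablePair.comp : ComposablePair X → ArrowSpace X)
  isOpenMap_source : IsOpenMap (sourceMap : ArrowSpace X → X)
  isOpenMap_range : IsOpenMap (rangeMap : ArrowSpace X → X)

end Groupoid

/-- The bundle space of a family `(E x)` of sets: the disjoint union of the fibres (the parameter
`Unit` is a dummy). It carries no topology by itself. -/
abbrev BundleSpace {X : Type*} (E : X → Type*) := TotalSpace Unit E

section HilbertBundle

variable (𝕜 : Type*) [RCLike 𝕜] {X : Type u} [TopologicalSpace X]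
  (E : X → Type w) [∀ x, NormedAddCommGroup (E x)] [∀ x, InnerProductSpace 𝕜 (E x)]
  [TopologicalSpace (BundleSpace E)]

/-- The family of inner product spaces `E x`, with the given topology on its bundle space, is a
Hilbert bundle over `X`. (The projection is surjective since every fibre contains `0`.)
In `continuous_add`, the space `E ×ᵇ E` of pairs of vectors in the same fibre carries the
subspace topology of the product. In `le_nhds_zero`, convergence of nets is expressed by filters. -/
class IsHilbertBundle : Prop where
  completeSpace : ∀ x, CompleteSpace (E x)
  continuous_proj : Continuous (fun u : BundleSpace E => u.proj)
  isOpenMap_proj : IsOpenMap (fun u : BundleSpace E => u.proj)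
  continuous_norm : Continuous (fun u : BundleSpace E => ‖u.snd‖)
  continuous_add : Continuous (fun p : TotalSpace (Unit × Unit) (E ×ᵇ E) =>
    (⟨p.proj, p.snd.1 + p.snd.2⟩ : BundleSpace E))
  continuous_smul : ∀ a : 𝕜,
    Continuous (fun u : BundleSpace E => (⟨u.proj, a • u.snd⟩ : BundleSpace E))
  le_nhds_zero : ∀ (x : X) (l : Filter (BundleSpace E)),
    Filter.Tendsto (fun u : BundleSpace E => ‖u.snd‖) l (𝓝 0) →
    Filter.Tendsto (fun u : BundleSpace E => u.proj) l (𝓝 x) → l ≤ 𝓝 ⟨x, 0⟩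

variable {E}

/-- `U(V; f₁, …, fₙ; ε)` around the point `p`, for `S = {f₁, …, fₙ}`. -/
def weakBasicNhd (V : Set X) (S : Set (∀ x, E x)) (ε : ℝ) (p : BundleSpace E) :
    Set (BundleSpace E) :=
  {q | q.proj ∈ V ∧
    ∀ f ∈ S, ‖inner 𝕜 (f q.proj) q.snd - inner 𝕜 (f p.proj) p.snd‖ < ε}

/-- `f` restricts to a continuous section over `V`; the values of `f` outside `V` are irrelevant. -/
def IsContinuousSectionOn (f : ∀ x, E x) (V : Set X) : Prop :=
  ContinuousOn (fun x => (⟨x, f x⟩ : BundleSpace E)) V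

/-- `W` contains some `U(V; f₁, …, fₙ; ε)` around `p`, where `V` is a compact (Hausdorff)
neighbourhood of the base point of `p`, the `fᵢ` are continuous sections over `V`, and `ε > 0`. -/
def IsWeakNhd (p : BundleSpace E) (W : Set (BundleSpace E)) : Prop :=
  ∃ V ∈ 𝓝 p.proj, IsCompact V ∧ T2Space V ∧
    ∃ S : Set (∀ x, E x), S.Finite ∧ (∀ f ∈ S, IsContinuousSectionOn f V) ∧
      ∃ ε : ℝ, 0 < ε ∧ weakBasicNhd 𝕜 V S ε p ⊆ W

theorem exists_compact_nhd_subset_inter {x : X} {V₁ V₂ : Set X} (h₁ : V₁ ∈ 𝓝 x) (h₂ : V₂ ∈ 𝓝 x)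
    (hc : IsCompact V₁) (ht : T2Space V₁) :
    ∃ V ∈ 𝓝 x, IsCompact V ∧ T2Space V ∧ V ⊆ V₁ ∧ V ⊆ V₂ := by
  have hx : x ∈ V₁ := mem_of_mem_nhds h₁
  have : CompactSpace V₁ := isCompact_iff_compactSpace.mp hc
  have hn : (Subtype.val ⁻¹' V₂ : Set V₁) ∈ 𝓝 (⟨x, hx⟩ : V₁) :=
    continuous_subtype_val.continuousAt.preimage_mem_nhds h₂
  obtain ⟨K, hK, hKs, hKc⟩ := local_compact_nhds hn
  refine ⟨Subtype.val '' K, ?_, hKc.image continuous_subtype_val, ?_, ?_, ?_⟩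
  · have := Filter.image_mem_map (m := (Subtype.val : V₁ → X)) hK
    rwa [map_nhds_subtype_coe_eq_nhds hx (Filter.mem_of_superset h₁ fun _ h => h)] at this
  · have hs : Subtype.val '' K ⊆ V₁ := by
      rintro _ ⟨y, -, rfl⟩
      exact y.2
    exact T2Space.of_injective_continuous (inclusion_injective hs) (continuous_inclusion hs)
  · rintro _ ⟨y, -, rfl⟩
    exact y.2
  · rintro _ ⟨y, hy, rfl⟩
    exact hKs hy

theorem IsWeakNhd.inter {p : BundleSpace E} {W₁ W₂ : Set (BundleSpace E)}
    (h₁ : IsWeakNhd 𝕜 p W₁) (h₂ : IsWeakNhd 𝕜 p W₂) : IsWeakNhd 𝕜 p (W₁ ∩ W₂) := by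
  obtain ⟨V₁, hV₁, hc₁, ht₁, S₁, hf₁, hs₁, ε₁, he₁, hW₁⟩ := h₁
  obtain ⟨V₂, hV₂, hc₂, ht₂, S₂, hf₂, hs₂, ε₂, he₂, hW₂⟩ := h₂
  obtain ⟨V, hV, hc, ht, hi₁, hi₂⟩ := exists_compact_nhd_subset_inter hV₁ hV₂ hc₁ ht₁
  refine ⟨V, hV, hc, ht, S₁ ∪ S₂, hf₁.union hf₂, ?_, min ε₁ ε₂, lt_min he₁ he₂, ?_⟩
  · rintro f (hf | hf)
    · exact ContinuousOn.mono (hs₁ f hf) hi₁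
    · exact ContinuousOn.mono (hs₂ f hf) hi₂
  · rintro q ⟨hq, hqS⟩
    exact ⟨hW₁ ⟨hi₁ hq, fun f hf => (hqS f (Or.inl hf)).trans_le (min_le_left _ _)⟩,
      hW₂ ⟨hi₂ hq, fun f hf => (hqS f (Or.inr hf)).trans_le (min_le_right _ _)⟩⟩

variable (E)

/-- The weak topology of the bundle space: a set is open if and only if it is a weak neighbourhood
of each of its points. -/
@[reducible] def weakTopology [LocallyCompactHausdorff X] : TopologicalSpace (BundleSpace E) where
  IsOpen W := ∀ p ∈ W, IsWeakNhd 𝕜 p W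
  isOpen_univ p _ := by
    obtain ⟨V, hV, hc, ht⟩ := LocallyCompactHausdorff.exists_nhd p.proj
    exact ⟨V, hV, hc, ht, ∅, Set.finite_empty, by simp, 1, one_pos, Set.subset_univ _⟩
  isOpen_inter W₁ W₂ h₁ h₂ p hp := (h₁ p hp.1).inter 𝕜 (h₂ p hp.2)
  isOpen_sUnion 𝒲 h p hp := by
    obtain ⟨W, hW, hpW⟩ := hp
    obtain ⟨V, hV, hc, ht, S, hf, hs, ε, he, hU⟩ := h W hW p hpW
    exact ⟨V, hV, hc, ht, S, hf, hs, ε, he, hU.trans (Set.subset_sUnion_of_mem hW)⟩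

variable {E}

/-- A subset of the bundle space is bounded if the norm function is bounded on it. -/
def IsBundleBounded {X : Type u} {E : X → Type w} [∀ x, NormedAddCommGroup (E x)]
    (A : Set (BundleSpace E)) : Prop :=
  ∃ R : ℝ, ∀ u ∈ A, ‖u.snd‖ ≤ R

/-- Each `A ∩ E x` is convex (with the real scalar multiplication underlying that of `𝕜`). -/
def IsFiberwiseConvex (A : Set (BundleSpace E)) : Prop :=
  ∀ x, letI := InnerProductSpace.rclikeToReal 𝕜 (E x)
    Convex ℝ {u : E x | (⟨x, u⟩ : BundleSpace E) ∈ A}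

variable [LocallyCompactHausdorff X]

/-- The convex hull `conv(A)`: the smallest fiberwise convex and weakly closed subset of the
bundle space containing `A`. -/
def bundleConvexHull (A : Set (BundleSpace E)) : Set (BundleSpace E) :=
  ⋂₀ {C | A ⊆ C ∧ IsFiberwiseConvex 𝕜 C ∧ IsClosed[weakTopology 𝕜 E] C}

theorem isLeast_bundleConvexHull (A : Set (BundleSpace E)) :
    IsLeast {C | A ⊆ C ∧ IsFiberwiseConvex 𝕜 C ∧ IsClosed[weakTopology 𝕜 E] C}
      (bundleConvexHull 𝕜 A) := by
  refine ⟨⟨Set.subset_sInter fun C hC => hC.1, fun x => ?_, ?_⟩,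
    fun C hC => Set.sInter_subset_of_mem hC⟩
  · intro u hu v hv a b ha hb hab C hC
    exact hC.2.1 x (hu C hC) (hv C hC) ha hb hab
  · exact @isClosed_sInter _ (weakTopology 𝕜 E) _ fun C hC => hC.2.2

end HilbertBundle

section Action

variable (𝕜 : Type*) [RCLike 𝕜] {X : Type u} [TopologicalSpace X] [Groupoid.{v} X]
  [TopologicalSpace (ArrowSpace X)]
  (E : X → Type w) [∀ x, NormedAddCommGroup (E x)] [∀ x, InnerProductSpace 𝕜 (E x)]
  [TopologicalSpace (BundleSpace E)]

/-- A continuous action of `G` on the bundle `E` by linear isometries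
`L(γ) : E_{s(γ)} → E_{r(γ)}`; together with `IsHilbertBundle 𝕜 E` it makes `E` a
`G`-Hilbert bundle. The space `G * E = {(γ, u) : s(γ) = π(u)}` is the pull-back `s^*E`
with its pull-back topology, i.e. the subspace topology of `G × E`. -/
structure IsometricAction where
  L : ∀ {x y : X}, (x ⟶ y) → (E x →ₗᵢ[𝕜] E y)
  map_id : ∀ (x : X) (u : E x), L (𝟙 x) u = u
  map_comp : ∀ {x y z : X} (g : x ⟶ y) (h : y ⟶ z) (u : E x), L (g ≫ h) u = L h (L g u)
  continuous_action : Continuous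
    (fun p : BundleSpace ((sourceMap : ArrowSpace X → X) *ᵖ E) =>
      (⟨p.proj.right, L p.proj.hom p.snd⟩ : BundleSpace E))

variable {𝕜 E}

/-- A continuous cocycle `c : G → r^*E`: a continuous section of the pull-back `r^*E` such that
`c(γ'γ) = c(γ') + L(γ') c(γ)`. -/
structure ContinuousCocycle (𝓛 : IsometricAction 𝕜 E) where
  c : ∀ {x y : X}, (x ⟶ y) → E y
  map_comp : ∀ {x y z : X} (g : x ⟶ y) (h : y ⟶ z), c (g ≫ h) = c h + 𝓛.L h (c g)
  continuous_section : Continuous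
    (fun g : ArrowSpace X =>
      (⟨g, c g.hom⟩ : BundleSpace ((rangeMap : ArrowSpace X → X) *ᵖ E)))

/-- The affine isometric action `γu = L(γ)u + c(γ)` defined by a cocycle. -/
def ContinuousCocycle.affineAction {𝓛 : IsometricAction 𝕜 E} (κ : ContinuousCocycle 𝓛)
    {x y : X} (g : x ⟶ y) (u : E x) : E y :=
  𝓛.L g u + κ.c g

/-- `A` is invariant under the affine action: `γu ∈ A` whenever `u ∈ A` and `s(γ) = π(u)`. -/
def ContinuousCocycle.IsInvariant {𝓛 : IsometricAction 𝕜 E} (κ : ContinuousCocycle 𝓛)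
    (A : Set (BundleSpace E)) : Prop :=
  ∀ {x y : X} (g : x ⟶ y) (u : E x),
    (⟨x, u⟩ : BundleSpace E) ∈ A → (⟨y, κ.affineAction g u⟩ : BundleSpace E) ∈ A

end Action

/-! Let `R` bound the norm on `A`, and let `C` be the set of vectors of norm at most `R` all of
whose translates lie in conv(A). Invariance of `A` gives `A ⊆ C`, and `C` is fiberwise convex since
arrows act affinely. If `C` is weakly closed, minimality yields conv(A) ⊆ `C`, which is the claim.

Closedness has two halves. Cauchy-Schwarz against sections shows that balls are weakly closed
(`isWeakNhd_norm_gt`). If γ₀u₀ lies outside conv(A), so does some translate of every u of norm at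
most `R` weakly near u₀ (`isWeakNhd_translate`). This rests on (f | γu) = (L(γ)⁻¹f | u) + (f |
c(γ)). The vector L(γ)⁻¹f(r(γ)) depends on γ and not only on its source, so near γ₀ it is replaced
by the value at the source of a continuous section; the error is uniform on bounded sets. Openness
of the source map supplies an arrow near γ₀ out of every point near its source.

Both halves need continuous local sections with values near a given vector
(`exists_section_norm_sub_lt`). Approximately continuous sections come from choice, partitions of
unity halve their defect, and completeness of the fibres provides the limit. -/

namespace HilbertBundle

/-! ### Continuity of the fibrewise operations. -/

variable (𝕜 : Type*) [RCLike 𝕜] {X : Type u} [TopologicalSpace X]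
  {E : X → Type w} [∀ x, NormedAddCommGroup (E x)] [∀ x, InnerProductSpace 𝕜 (E x)]
  [TopologicalSpace (BundleSpace E)]

/-- The vector `u` of the fibre over `x`, as a point of the bundle space. -/
abbrev toBundle {x : X} (u : E x) : BundleSpace E := ⟨x, u⟩

omit [TopologicalSpace X] [∀ x, NormedAddCommGroup (E x)] in
theorem exists_nhds_of_mem_nhds_prod {x : X} {u v : E x}
    {s : Set (TotalSpace (Unit × Unit) (E ×ᵇ E))} (hs : s ∈ 𝓝 ⟨x, (u, v)⟩) :
    ∃ N₁ ∈ 𝓝 (toBundle u), ∃ N₂ ∈ 𝓝 (toBundle v), ∀ (y : X) (a b : E y),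
      toBundle a ∈ N₁ → toBundle b ∈ N₂ → (⟨y, (a, b)⟩ : TotalSpace (Unit × Unit) (E ×ᵇ E)) ∈ s := by
  rw [(FiberBundle.Prod.isInducing_diag Unit E Unit E).nhds_eq_comap, Filter.mem_comap] at hs
  obtain ⟨t, ht, hts⟩ := hs
  obtain ⟨N₁, h₁, N₂, h₂, h⟩ := mem_nhds_prod_iff.mp ht
  exact ⟨N₁, h₁, N₂, h₂, fun y a b ha hb => hts (h ⟨ha, hb⟩)⟩

variable [IsHilbertBundle 𝕜 E]

section Tendsto

variable {ι : Type*} {l : Filter ι} {y : ι → X} {a b : ∀ i, E (y i)} {x : X} {u v : E x}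

include 𝕜

theorem tendsto_proj (ha : Filter.Tendsto (fun i => toBundle (a i)) l (𝓝 (toBundle u))) :
    Filter.Tendsto y l (𝓝 x) :=
  ((IsHilbertBundle.continuous_proj 𝕜 (E := E)).tendsto (toBundle u)).comp ha

theorem tendsto_norm (ha : Filter.Tendsto (fun i => toBundle (a i)) l (𝓝 (toBundle u))) :
    Filter.Tendsto (fun i => ‖a i‖) l (𝓝 ‖u‖) :=
  ((IsHilbertBundle.continuous_norm 𝕜 (E := E)).tendsto (toBundle u)).comp ha

theorem tendsto_zero (hy : Filter.Tendsto y l (𝓝 x))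
    (ha : Filter.Tendsto (fun i => ‖a i‖) l (𝓝 0)) :
    Filter.Tendsto (fun i => toBundle (a i)) l (𝓝 (toBundle (0 : E x))) :=
  IsHilbertBundle.le_nhds_zero 𝕜 x (Filter.map (fun i => toBundle (a i)) l)
    (Filter.tendsto_map'_iff.mpr ha) (Filter.tendsto_map'_iff.mpr hy)

theorem tendsto_add (ha : Filter.Tendsto (fun i => toBundle (a i)) l (𝓝 (toBundle u)))
    (hb : Filter.Tendsto (fun i => toBundle (b i)) l (𝓝 (toBundle v))) :
    Filter.Tendsto (fun i => toBundle (a i + b i)) l (𝓝 (toBundle (u + v))) := by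
  have hp : Filter.Tendsto
      (fun i => (⟨y i, (a i, b i)⟩ : TotalSpace (Unit × Unit) (E ×ᵇ E))) l
      (𝓝 ⟨x, (u, v)⟩) := by
    rw [(FiberBundle.Prod.isInducing_diag Unit E Unit E).tendsto_nhds_iff]
    exact ha.prodMk_nhds hb
  exact ((IsHilbertBundle.continuous_add 𝕜 (E := E)).tendsto ⟨x, (u, v)⟩).comp hp

theorem tendsto_const_smul (c : 𝕜)
    (ha : Filter.Tendsto (fun i => toBundle (a i)) l (𝓝 (toBundle u))) :
    Filter.Tendsto (fun i => toBundle (c • a i)) l (𝓝 (toBundle (c • u))) :=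
  ((IsHilbertBundle.continuous_smul (E := E) c).tendsto (toBundle u)).comp ha

theorem tendsto_sub (ha : Filter.Tendsto (fun i => toBundle (a i)) l (𝓝 (toBundle u)))
    (hb : Filter.Tendsto (fun i => toBundle (b i)) l (𝓝 (toBundle v))) :
    Filter.Tendsto (fun i => toBundle (a i - b i)) l (𝓝 (toBundle (u - v))) := by
  simpa [sub_eq_add_neg] using tendsto_add 𝕜 ha (tendsto_const_smul 𝕜 (-1) hb)

/-- The axioms give continuity only for a fixed scalar; the error `(c i - c₀) • a i` has norm
tending to zero, so the axiom on null nets absorbs it. -/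
theorem tendsto_smul {c : ι → 𝕜} {c₀ : 𝕜} (hc : Filter.Tendsto c l (𝓝 c₀))
    (ha : Filter.Tendsto (fun i => toBundle (a i)) l (𝓝 (toBundle u))) :
    Filter.Tendsto (fun i => toBundle (c i • a i)) l (𝓝 (toBundle (c₀ • u))) := by
  have h₁ : Filter.Tendsto (fun i => ‖(c i - c₀) • a i‖) l (𝓝 0) := by
    simp only [norm_smul]
    simpa using ((tendsto_sub_nhds_zero_iff.mpr hc).norm).mul (tendsto_norm 𝕜 ha)
  have h₂ := tendsto_add 𝕜 (tendsto_const_smul 𝕜 c₀ ha)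
    (tendsto_zero 𝕜 (tendsto_proj 𝕜 ha) h₁)
  simpa [sub_smul] using h₂

/-- Polarization reduces this to continuity of the norm. -/
theorem tendsto_inner (ha : Filter.Tendsto (fun i => toBundle (a i)) l (𝓝 (toBundle u)))
    (hb : Filter.Tendsto (fun i => toBundle (b i)) l (𝓝 (toBundle v))) :
    Filter.Tendsto (fun i => inner 𝕜 (a i) (b i)) l (𝓝 (inner 𝕜 u v)) := by
  have hofReal {f : ι → ℝ} {t : ℝ} (h : Filter.Tendsto f l (𝓝 t)) :
      Filter.Tendsto (fun i => (f i : 𝕜)) l (𝓝 (t : 𝕜)) :=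
    (RCLike.continuous_ofReal.tendsto t).comp h
  have hI := tendsto_const_smul 𝕜 RCLike.I hb
  have h₁ := (hofReal (tendsto_norm 𝕜 (tendsto_add 𝕜 ha hb))).pow 2
  have h₂ := (hofReal (tendsto_norm 𝕜 (tendsto_sub 𝕜 ha hb))).pow 2
  have h₃ := (hofReal (tendsto_norm 𝕜 (tendsto_sub 𝕜 ha hI))).pow 2
  have h₄ := (hofReal (tendsto_norm 𝕜 (tendsto_add 𝕜 ha hI))).pow 2
  simp only [inner_eq_sum_norm_sq_div_four]
  exact ((h₁.sub h₂).add ((h₃.sub h₄).mul_const _)).div_const 4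

end Tendsto

include 𝕜

theorem exists_nhds_add {x : X} {u v : E x} {N : Set (BundleSpace E)}
    (hN : N ∈ 𝓝 (toBundle (u + v))) :
    ∃ N₁ ∈ 𝓝 (toBundle u), ∃ N₂ ∈ 𝓝 (toBundle v), ∀ (y : X) (a b : E y),
      toBundle a ∈ N₁ → toBundle b ∈ N₂ → toBundle (a + b) ∈ N :=
  exists_nhds_of_mem_nhds_prod
    ((IsHilbertBundle.continuous_add 𝕜 (E := E)).continuousAt (x := ⟨x, (u, v)⟩) hN)

theorem exists_nhds_norm_sub_lt {x : X} (u v : E x) {ε : ℝ} (h : ‖u - v‖ < ε) :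
    ∃ N₁ ∈ 𝓝 (toBundle u), ∃ N₂ ∈ 𝓝 (toBundle v), ∀ (y : X) (a b : E y),
      toBundle a ∈ N₁ → toBundle b ∈ N₂ → ‖a - b‖ < ε := by
  have hd := (FiberBundle.Prod.isInducing_diag Unit E Unit E).continuous.tendsto ⟨x, (u, v)⟩
  have := tendsto_norm 𝕜 (tendsto_sub 𝕜 hd.fst_nhds hd.snd_nhds)
  exact exists_nhds_of_mem_nhds_prod (this.eventually_lt_const h)

/-- Openness of the projection, over a subset `V` of the base. -/
theorem eventually_exists_mem {V : Set X} {x : V} {u : E x} {N : Set (BundleSpace E)}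
    (hN : N ∈ 𝓝 (toBundle u)) : ∀ᶠ y : V in 𝓝 x, ∃ q : E y, toBundle q ∈ N := by
  have h : (fun u : BundleSpace E => u.proj) '' N ∈ 𝓝 (x : X) :=
    (IsHilbertBundle.isOpenMap_proj 𝕜 (E := E)).image_mem_nhds hN
  filter_upwards [continuous_subtype_val.continuousAt.preimage_mem_nhds h] with y hy
  obtain ⟨⟨z, q⟩, hq, hz⟩ := hy
  obtain rfl : z = y := hz
  exact ⟨q, hq⟩

end HilbertBundle

/-! ### Existence of continuous local sections. -/

namespace HilbertBundle

variable (𝕜 : Type*) [RCLike 𝕜] {X : Type u} [TopologicalSpace X]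
  {E : X → Type w} [∀ x, NormedAddCommGroup (E x)] [∀ x, InnerProductSpace 𝕜 (E x)]
  [TopologicalSpace (BundleSpace E)]

/-- The vectors `q` in the bundle space close to `u` satisfy `‖q - f (π q)‖ < ε`. -/
def IsNear {V : Set X} (f : ∀ y : V, E y) {x : V} (u : E x) (ε : ℝ) : Prop :=
  ∃ N ∈ 𝓝 (toBundle u), ∀ (y : V) (q : E y), toBundle q ∈ N → ‖q - f y‖ < ε

variable [IsHilbertBundle 𝕜 E] {V : Set X} {f g : ∀ y : V, E y} {x : V} {u v : E x} {ε δ : ℝ}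

omit [TopologicalSpace X] in
theorem IsNear.norm_sub_lt (h : IsNear f u ε) : ‖u - f x‖ < ε := by
  obtain ⟨N, hN, h⟩ := h
  exact h x u (mem_of_mem_nhds hN)

include 𝕜

/-- If near `x` the values of `f` are `ε`-close to vectors close to `u`, then `f` is near every
vector `v` in the fibre of `u`. -/
theorem isNear_of_eventually (huv : ‖v - u‖ + ε < δ)
    (h : ∀ N ∈ 𝓝 (toBundle u), ∀ᶠ y : V in 𝓝 x, ∃ q : E y, toBundle q ∈ N ∧ ‖q - f y‖ ≤ ε) :
    IsNear f v δ := by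
  obtain ⟨N₁, h₁, N₂, h₂, hN⟩ := exists_nhds_norm_sub_lt 𝕜 v u (lt_sub_iff_add_lt.mpr huv)
  obtain ⟨T, hT, hTs⟩ := mem_nhds_subtype V x _ |>.mp (h N₂ h₂)
  refine ⟨N₁ ∩ (fun p : BundleSpace E => p.proj) ⁻¹' T, Filter.inter_mem h₁
    ((IsHilbertBundle.continuous_proj 𝕜 (E := E)).continuousAt (x := toBundle v) hT), ?_⟩
  rintro y q ⟨hq, hy⟩
  obtain ⟨q', hq', hf⟩ := hTs hy
  have := norm_sub_le_norm_sub_add_norm_sub q q' (f y)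
  have := hN y q q' hq hq'
  linarith

theorem IsNear.eventually_and (h : IsNear f u ε) {N : Set (BundleSpace E)}
    (hN : N ∈ 𝓝 (toBundle u)) :
    ∀ᶠ y : V in 𝓝 x, ∃ q : E y, toBundle q ∈ N ∧ ‖q - f y‖ < ε := by
  obtain ⟨N', hN', h⟩ := h
  filter_upwards [eventually_exists_mem 𝕜 (Filter.inter_mem hN hN')] with y ⟨q, hq⟩
  exact ⟨q, hq.1, h y q hq.2⟩

theorem IsNear.congr (h : IsNear f u ε) {η : ℝ} (hfg : ∀ y, ‖f y - g y‖ ≤ η)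
    (huv : ‖v - u‖ + (ε + η) < δ) : IsNear g v δ := by
  refine isNear_of_eventually 𝕜 huv fun N hN => ?_
  filter_upwards [h.eventually_and 𝕜 hN] with y ⟨q, hq, hqf⟩
  refine ⟨q, hq, ?_⟩
  have := norm_sub_le_norm_sub_add_norm_sub q (f y) (g y)
  have := hfg y
  linarith

/-- Choose an arbitrary vector in each fibre meeting a thin neighbourhood of `u`. The default 0 on
the other fibres is harmless, since nearness only tests vectors of that neighbourhood. -/
theorem exists_isNear (u : E x) (hε : 0 < ε) : ∃ f : ∀ y : V, E y, IsNear f u ε := by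
  classical
  obtain ⟨N₁, h₁, N₂, h₂, hN⟩ := exists_nhds_norm_sub_lt 𝕜 u u (ε := ε) (by simpa using hε)
  refine ⟨fun y => if h : ∃ q : E y, toBundle q ∈ N₁ ∩ N₂ then h.choose else 0, N₁ ∩ N₂,
    Filter.inter_mem h₁ h₂, fun y q hq => ?_⟩
  have h : ∃ q : E y, toBundle q ∈ N₁ ∩ N₂ := ⟨q, hq⟩
  simp only [dif_pos h]
  exact hN y q _ hq.1 h.choose_spec.2

theorem IsNear.eventually_exists (h : IsNear f u ε) :
    ∀ᶠ y : V in 𝓝 x, ∃ q : E y, IsNear f q ε := by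
  obtain ⟨N, hN, h⟩ := h
  filter_upwards [eventually_exists_mem 𝕜 (interior_mem_nhds.mpr hN)] with y ⟨q, hq⟩
  exact ⟨q, N, mem_interior_iff_mem_nhds.mp hq, h⟩

theorem IsNear.eventually_norm_sub_lt (hf : IsNear f u ε) (hg : IsNear g u δ) :
    ∀ᶠ y : V in 𝓝 x, ‖f y - g y‖ < ε + δ := by
  obtain ⟨N, hN, hg⟩ := hg
  filter_upwards [hf.eventually_and 𝕜 hN] with y ⟨q, hq, hqf⟩
  have h₁ := norm_sub_le_norm_sub_add_norm_sub (f y) q (g y)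
  rw [norm_sub_rev (f y) q] at h₁
  have := hg y q hq
  linarith

/-- This is the axiom on null nets, applied to the coarsest filter satisfying its hypotheses. -/
theorem exists_nhds_zero {x : X} {N : Set (BundleSpace E)} (hN : N ∈ 𝓝 (toBundle (0 : E x))) :
    ∃ T ∈ 𝓝 x, ∃ δ > 0, ∀ y ∈ T, ∀ b : E y, ‖b‖ < δ → toBundle b ∈ N := by
  have h := IsHilbertBundle.le_nhds_zero 𝕜 (E := E) x
    (Filter.comap (fun u : BundleSpace E => u.proj) (𝓝 x) ⊓
      Filter.comap (fun u : BundleSpace E => ‖u.snd‖) (𝓝 0))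
    (Filter.tendsto_comap.mono_left inf_le_right) (Filter.tendsto_comap.mono_left inf_le_left) hN
  rw [(((𝓝 x).basis_sets.comap _).inf (Metric.nhds_basis_ball.comap _)).mem_iff] at h
  obtain ⟨⟨T, δ⟩, ⟨hT, hδ⟩, h⟩ := h
  exact ⟨T, hT, δ, hδ, fun y hy b hb => h ⟨hy, by simpa using hb⟩⟩

/-- Write `f y = q + (f y - q)` with `q` close to `f x` in the bundle; the remainder is small in
norm, hence close to the zero vector over `x`. -/
theorem continuousAt_of_isNear (h : ∀ ε > 0, IsNear f (f x) ε) :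
    ContinuousAt (fun y : V => toBundle (f y)) x := by
  intro N hN
  replace hN : N ∈ 𝓝 (toBundle (f x + 0)) := by rwa [add_zero]
  obtain ⟨N₁, h₁, N₂, h₂, hadd⟩ := exists_nhds_add 𝕜 hN
  obtain ⟨T, hT, δ, hδ, hz⟩ := exists_nhds_zero 𝕜 h₂
  rw [Filter.mem_map]
  filter_upwards [(h δ hδ).eventually_and 𝕜 h₁,
    continuous_subtype_val.continuousAt.preimage_mem_nhds hT] with y ⟨q, hq, hqf⟩ hy
  have := hadd y q (f y - q) hq (hz y hy _ (by rwa [norm_sub_rev]))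
  simpa using this

theorem exists_nhds_smul (c : 𝕜) {x : X} {u : E x} {N : Set (BundleSpace E)}
    (hN : N ∈ 𝓝 (toBundle (c • u))) :
    ∃ N' ∈ 𝓝 (toBundle u), ∃ T ∈ 𝓝 c, ∀ (y : X) (a : E y) (t : 𝕜),
      toBundle a ∈ N' → t ∈ T → toBundle (t • a) ∈ N := by
  have h : Filter.Tendsto (fun p : BundleSpace E × 𝕜 => toBundle (p.2 • p.1.snd))
      (𝓝 (toBundle u) ×ˢ 𝓝 c) (𝓝 (toBundle (c • u))) :=
    tendsto_smul 𝕜 (a := fun p : BundleSpace E × 𝕜 => p.1.snd) Filter.tendsto_snd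
      Filter.tendsto_fst
  obtain ⟨N', hN', T, hT, h⟩ := Filter.mem_prod_iff.mp (h hN)
  exact ⟨N', hN', T, hT, fun y a t ha ht => h (show ((toBundle a, t) : BundleSpace E × 𝕜) ∈ _
    from ⟨ha, ht⟩)⟩

/-- A convex combination with continuous coefficients of sections which are `ε`-close to
continuous ones is itself such a section. -/
theorem exists_isNear_sum {ι : Type*} [Fintype ι] (ρ : ι → C(V, ℝ)) (hρ : ∀ i y, 0 ≤ ρ i y)
    (hsum : ∀ y, ∑ i, ρ i y = 1) (f : ι → ∀ y : V, E y) (hεδ : ε < δ)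
    (hf : ∀ i, x ∈ tsupport (ρ i) → ∃ u : E x, IsNear (f i) u ε) :
    ∃ u : E x, IsNear (fun y => ∑ i, (ρ i y : 𝕜) • f i y) u δ := by
  classical
  -- Weighting the error by the partial sum of the coefficients makes it exactly `ε` for the full
  -- sum. Indices with `x` outside the support vanish near `x`, so nothing is required of their
  -- sections.
  have key : ∀ J : Finset ι, ∃ u : E x, ∀ N ∈ 𝓝 (toBundle u), ∀ᶠ y : V in 𝓝 x,
      ∃ q : E y, toBundle q ∈ N ∧
        ‖q - ∑ i ∈ J, (ρ i y : 𝕜) • f i y‖ ≤ (∑ i ∈ J, ρ i y) * ε := by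
    intro J
    induction J using Finset.induction_on with
    | empty =>
      refine ⟨0, fun N hN => ?_⟩
      obtain ⟨T, hT, δ, hδ, hz⟩ := exists_nhds_zero 𝕜 hN
      filter_upwards [continuous_subtype_val.continuousAt.preimage_mem_nhds hT] with y hy
      exact ⟨0, hz y hy 0 (by simpa using hδ), by simp⟩
    | insert i J hi ih =>
      obtain ⟨v, hv⟩ := ih
      by_cases hx : x ∈ tsupport (ρ i)
      · obtain ⟨u, hu⟩ := hf i hx
        refine ⟨(ρ i x : 𝕜) • u + v, fun N hN => ?_⟩
        obtain ⟨N₁, h₁, N₂, h₂, hadd⟩ := exists_nhds_add 𝕜 hN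
        obtain ⟨N', hN', T, hT, hsmul⟩ := exists_nhds_smul 𝕜 _ h₁
        have hρc : ContinuousAt (fun y => (ρ i y : 𝕜)) x :=
          (RCLike.continuous_ofReal.comp (ρ i).continuous).continuousAt
        filter_upwards [hu.eventually_and 𝕜 hN', hv N₂ h₂, hρc hT] with y ⟨a, ha, haf⟩ ⟨b, hb, hbf⟩ ht
        refine ⟨(ρ i y : 𝕜) • a + b, hadd y _ _ (hsmul y a _ ha ht) hb, ?_⟩
        rw [Finset.sum_insert hi, Finset.sum_insert hi, add_sub_add_comm, ← smul_sub, add_mul]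
        refine (norm_add_le _ _).trans (add_le_add ?_ hbf)
        rw [norm_smul, RCLike.norm_ofReal, abs_of_nonneg (hρ i y)]
        exact mul_le_mul_of_nonneg_left haf.le (hρ i y)
      · refine ⟨v, fun N hN => ?_⟩
        filter_upwards [hv N hN, notMem_tsupport_iff_eventuallyEq.mp hx] with y hy h0
        simpa [Finset.sum_insert hi, h0] using hy
  obtain ⟨u, hu⟩ := key Finset.univ
  refine ⟨u, isNear_of_eventually 𝕜 (u := u) (ε := ε) (by simpa using hεδ) fun N hN => ?_⟩
  filter_upwards [hu N hN] with y hy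
  simpa [hsum] using hy

/-- A section over a compact set which is `ε`-close to continuous is `2ε`-close to a section which
is `ε/2`-close to continuous. -/
theorem exists_isNear_half [CompactSpace V] [T2Space V] (hε : 0 < ε)
    (hf : ∀ x : V, ∃ u : E x, IsNear f u ε) :
    ∃ g : ∀ y : V, E y, (∀ x : V, ∃ u : E x, IsNear g u (ε / 2)) ∧ ∀ y, ‖f y - g y‖ ≤ 2 * ε := by
  have hε4 : 0 < ε / 4 := by linarith
  choose u hu using hf
  choose h hh using fun x => exists_isNear 𝕜 (u x) hε4
  have hW : ∀ x, ∀ᶠ y : V in 𝓝 x, (∃ q : E y, IsNear (h x) q (ε / 4)) ∧ ‖f y - h x y‖ ≤ 2 * ε := by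
    intro x
    filter_upwards [(hh x).eventually_exists 𝕜, (hu x).eventually_norm_sub_lt 𝕜 (hh x)] with y h₁ h₂
    exact ⟨h₁, by linarith⟩
  obtain ⟨t, -, ht⟩ := isCompact_univ.elim_nhds_subcover
    (fun x : V => interior {y : V | (∃ q : E y, IsNear (h x) q (ε / 4)) ∧ ‖f y - h x y‖ ≤ 2 * ε})
    (fun x _ => interior_mem_nhds.mpr (hW x))
  obtain ⟨ρ, hρ⟩ := PartitionOfUnity.exists_isSubordinate isClosed_univ
    (fun i : t => interior
      {y : V | (∃ q : E y, IsNear (h i) q (ε / 4)) ∧ ‖f y - h i y‖ ≤ 2 * ε})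
    (fun i => isOpen_interior) (by simpa [iUnion_subtype] using ht)
  have hsum : ∀ y, ∑ i, ρ i y = 1 := fun y => by
    rw [← finsum_eq_sum_of_fintype]; exact ρ.sum_eq_one (mem_univ y)
  refine ⟨fun y => ∑ i : t, (ρ i y : 𝕜) • h i y, fun x => exists_isNear_sum 𝕜 (fun i => ρ i)
    (fun i y => ρ.nonneg i y) hsum (fun i => h i) (ε := ε / 4) (by linarith)
    fun i hi => (interior_subset (hρ i hi)).1, fun y => ?_⟩
  have hfy : f y = ∑ i : t, (ρ i y : 𝕜) • f y := by
    rw [← Finset.sum_smul, ← RCLike.ofReal_sum, hsum]; simp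
  rw [hfy, ← Finset.sum_sub_distrib]
  calc ‖∑ i : t, ((ρ i y : 𝕜) • f y - (ρ i y : 𝕜) • h i y)‖
      ≤ ∑ i : t, ρ i y * (2 * ε) := by
        refine norm_sum_le_of_le _ fun i _ => ?_
        rw [← smul_sub, norm_smul, RCLike.norm_ofReal, abs_of_nonneg (ρ.nonneg i y)]
        -- The distance to `h i y` is controlled only on the support of `ρ i`; elsewhere the term is
        -- zero.
        by_cases h0 : ρ i y = 0
        · simp [h0]
        · exact mul_le_mul_of_nonneg_left
            (interior_subset (hρ i (subset_tsupport _ h0))).2 (ρ.nonneg i y)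
    _ = 2 * ε := by rw [← Finset.sum_mul, hsum, one_mul]

/-- A section over a compact set which is `ε`-close to continuous is uniformly close to a
continuous section. -/
theorem exists_continuous_section [CompactSpace V] [T2Space V] (hε : 0 < ε)
    (hf : ∀ x : V, ∃ u : E x, IsNear f u ε) :
    ∃ g : ∀ y : V, E y, Continuous (fun y : V => toBundle (g y)) ∧ ∀ y, ‖f y - g y‖ ≤ 4 * ε := by
  have hpos : ∀ n : ℕ, 0 < ε / 2 ^ n := fun n => by positivity
  let S (n : ℕ) := {f : ∀ y : V, E y // ∀ x : V, ∃ u : E x, IsNear f u (ε / 2 ^ n)}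
  have step (n : ℕ) (F : S n) : ∃ G : S (n + 1), ∀ y, ‖F.1 y - G.1 y‖ ≤ 2 * (ε / 2 ^ n) := by
    obtain ⟨g, hg, hfg⟩ := exists_isNear_half 𝕜 (hpos n) F.2
    exact ⟨⟨g, by simpa [pow_succ, div_div] using hg⟩, hfg⟩
  choose next hnext using step
  let F (n : ℕ) : S n := Nat.rec ⟨f, by simpa using hf⟩ next n
  have hF : ∀ y n, dist ((F n).1 y) ((F (n + 1)).1 y) ≤ 4 * ε / 2 / 2 ^ n := by
    intro y n
    rw [dist_eq_norm]
    refine (hnext n (F n) y).trans_eq ?_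
    ring
  have hlim : ∀ y, ∃ a, Filter.Tendsto (fun n => (F n).1 y) Filter.atTop (𝓝 a) := fun y =>
    haveI := IsHilbertBundle.completeSpace 𝕜 (E := E) (y : X)
    cauchySeq_tendsto_of_complete (cauchySeq_of_le_geometric_two (hF y))
  choose g hg using hlim
  have hd : ∀ n y, ‖(F n).1 y - g y‖ ≤ 4 * ε / 2 ^ n := fun n y => by
    rw [← dist_eq_norm]
    exact dist_le_of_le_geometric_two_of_tendsto (hF y) (hg y) n
  refine ⟨g, continuous_iff_continuousAt.mpr fun x => continuousAt_of_isNear 𝕜 fun δ hδ => ?_,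
    fun y => (hd 0 y).trans_eq (by simp)⟩
  -- With η = ε/2ⁿ, passing from `F n` to `g` costs 4η, its own defect is η, and `g x` is within 5η
  -- of `u`: 10η in all.
  obtain ⟨n, hn⟩ := exists_pow_lt_of_lt_one (show 0 < δ / (10 * ε) by positivity)
    (show (1 / 2 : ℝ) < 1 by norm_num)
  have hn' : 10 * (ε / 2 ^ n) < δ := by
    rw [lt_div_iff₀ (by positivity), one_div, inv_pow] at hn
    calc 10 * (ε / 2 ^ n) = (2 ^ n)⁻¹ * (10 * ε) := by ring
      _ < δ := hn
  obtain ⟨u, hu⟩ := (F n).2 x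
  refine hu.congr 𝕜 (hd n) ?_
  have h₁ := norm_sub_le_norm_sub_add_norm_sub (g x) ((F n).1 x) u
  rw [norm_sub_rev (g x) ((F n).1 x), norm_sub_rev ((F n).1 x) u] at h₁
  have := hu.norm_sub_lt
  have := hd n x
  have : 4 * ε / 2 ^ n = 4 * (ε / 2 ^ n) := by ring
  linarith

/-- Every vector is approximated by the values of continuous local sections. -/
theorem exists_section_norm_sub_lt [LocallyCompactHausdorff X] {x : X} (u : E x) (hε : 0 < ε) :
    ∃ V ∈ 𝓝 x, ∃ f : ∀ x, E x, IsContinuousSectionOn f V ∧ ‖f x - u‖ < ε := by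
  classical
  obtain ⟨K, hK, hKc, hKt⟩ := LocallyCompactHausdorff.exists_nhd x
  -- One fifth for the distance from `u` to the rough section, four fifths for making it continuous.
  have hε5 : 0 < ε / 5 := by linarith
  obtain ⟨f, hf⟩ := exists_isNear 𝕜 (V := K) (x := ⟨x, mem_of_mem_nhds hK⟩) u hε5
  obtain ⟨T, hT, hTs⟩ := (mem_nhds_subtype K _ _).mp (hf.eventually_exists 𝕜)
  obtain ⟨V, hV, hVc, hVt, hVK, hVT⟩ := exists_compact_nhd_subset_inter hK hT hKc hKt
  have : CompactSpace V := isCompact_iff_compactSpace.mp hVc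
  obtain ⟨g, hg, hfg⟩ := exists_continuous_section 𝕜 (V := V) (f := fun y => f ⟨y, hVK y.2⟩) hε5
    fun y => by
      obtain ⟨q, N, hN, hq⟩ := hTs (show (⟨y, hVK y.2⟩ : K) ∈ Subtype.val ⁻¹' T from hVT y.2)
      exact ⟨q, N, hN, fun z => hq ⟨z, hVK z.2⟩⟩
  refine ⟨V, hV, fun y => if h : y ∈ V then g ⟨y, h⟩ else 0, ?_, ?_⟩
  · rw [IsContinuousSectionOn, continuousOn_iff_continuous_domRestrict]
    refine hg.congr fun y => ?_
    simp
  · have hx := mem_of_mem_nhds hV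
    have h₁ := hfg ⟨x, hx⟩
    have h₂ := hf.norm_sub_lt
    simp only [dif_pos hx]
    rw [norm_sub_rev] at h₁ h₂
    have := norm_sub_le_norm_sub_add_norm_sub (g ⟨x, hx⟩) (f ⟨x, hVK hx⟩) u
    linarith

end HilbertBundle

/-! ### Weak closedness of balls and weak continuity of the action. -/

namespace HilbertBundle

/-- A neighbourhood of a vector of norm larger than `R` in the weak topology contains only such
vectors. -/
theorem isWeakNhd_norm_gt (𝕜 : Type*) [RCLike 𝕜] {X : Type u} [TopologicalSpace X]
    [LocallyCompactHausdorff X] {E : X → Type w} [∀ x, NormedAddCommGroup (E x)]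
    [∀ x, InnerProductSpace 𝕜 (E x)] [TopologicalSpace (BundleSpace E)] [IsHilbertBundle 𝕜 E]
    {x : X} {u : E x} {R : ℝ} (h : R < ‖u‖) :
    IsWeakNhd 𝕜 (toBundle u) {q : BundleSpace E | R < ‖q.snd‖} := by
  -- A negative bound on the norm can occur only for an empty set; no section is needed then.
  rcases lt_or_ge R 0 with hR | hR
  · obtain ⟨V, hV, hVc, hVt⟩ := LocallyCompactHausdorff.exists_nhd x
    exact ⟨V, hV, hVc, hVt, ∅, finite_empty, by simp, 1, one_pos,
      fun q _ => hR.trans_le (norm_nonneg _)⟩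
  set m := ‖u‖ with hm
  have hm0 : 0 < m := hR.trans_lt h
  -- the sections are taken so close to `u` that the Cauchy-Schwarz inequality decides
  obtain ⟨δ, hδ, hδR⟩ : ∃ δ > 0, R * (m + 2 * δ) + δ < m * m - m * δ := by
    -- The inequality amounts to `δ * (2 * R + 1 + m) < m * (m - R)`; this `δ` makes the left side
    -- half the right.
    refine ⟨m * (m - R) / (2 * (2 * R + 1 + m)), by
      have := sub_pos.mpr h; positivity, ?_⟩
    have h₁ : m * (m - R) / (2 * (2 * R + 1 + m)) * (2 * (2 * R + 1 + m)) = m * (m - R) :=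
      div_mul_cancel₀ _ (by positivity)
    have : 0 < m * (m - R) := mul_pos hm0 (sub_pos.mpr h)
    linarith
  obtain ⟨V₁, hV₁, f, hf, hfu⟩ := exists_section_norm_sub_lt 𝕜 u hδ
  have hfx : Filter.Tendsto (fun y => toBundle (f y)) (𝓝 x) (𝓝 (toBundle (f x))) :=
    hf.continuousAt hV₁
  have hfm : ‖f x‖ < m + 2 * δ := by
    have := norm_sub_norm_le (f x) u
    linarith
  obtain ⟨K, hK, hKc, hKt⟩ := LocallyCompactHausdorff.exists_nhd x
  obtain ⟨V, hV, hVc, hVt, -, hVs⟩ := exists_compact_nhd_subset_inter hK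
    (Filter.inter_mem hV₁ ((tendsto_norm 𝕜 hfx).eventually_lt_const hfm)) hKc hKt
  refine ⟨V, hV, hVc, hVt, {f}, finite_singleton f, ?_, δ, hδ, ?_⟩
  · rintro _ rfl
    exact hf.mono fun y hy => (hVs hy).1
  · rintro ⟨y, q⟩ ⟨hy, hq⟩
    have hq' := hq f rfl
    have hfy : ‖f y‖ < m + 2 * δ := (hVs hy).2
    -- If `‖q‖ ≤ R`, the pairing at `q` has modulus at most `(m + 2 * δ) * R`, the one at `u` at
    -- least `m * m - m * δ`; they then differ by more than `δ`.
    by_contra hqR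
    simp only [mem_ofPred_eq, not_lt] at hqR
    dsimp only at hq' hqR
    have h₁ : m * m - m * δ ≤ ‖(inner 𝕜 (f x) u : 𝕜)‖ := by
      have h₂ : (inner 𝕜 (f x) u : 𝕜) = inner 𝕜 u u + inner 𝕜 (f x - u) u := by
        rw [← inner_add_left, add_sub_cancel]
      have h₃ : ‖(inner 𝕜 u u : 𝕜)‖ = m * m := by
        rw [inner_self_eq_norm_sq_to_K, norm_pow, RCLike.norm_ofReal, abs_norm, sq]
      have h₄ := norm_sub_le_norm_add (inner 𝕜 u u : 𝕜) (inner 𝕜 (f x - u) u)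
      have h₅ : ‖(inner 𝕜 (f x - u) u : 𝕜)‖ ≤ δ * m :=
        (norm_inner_le_norm _ _).trans (mul_le_mul_of_nonneg_right hfu.le hm0.le)
      rw [h₂]
      linarith
    have h₆ : ‖(inner 𝕜 (f y) q : 𝕜)‖ ≤ (m + 2 * δ) * R :=
      (norm_inner_le_norm _ _).trans (mul_le_mul hfy.le hqR (norm_nonneg _) (by positivity))
    have h₇ := norm_sub_norm_le (inner 𝕜 (f x) u : 𝕜) (inner 𝕜 (f y) q)
    rw [norm_sub_rev] at h₇
    linarith

section Action

variable {𝕜 : Type*} [RCLike 𝕜] {X : Type u} [TopologicalSpace X] [Groupoid.{v} X]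
  [TopologicalSpace (ArrowSpace X)]
  {E : X → Type w} [∀ x, NormedAddCommGroup (E x)] [∀ x, InnerProductSpace 𝕜 (E x)]
  [TopologicalSpace (BundleSpace E)] {𝓛 : IsometricAction 𝕜 E}

-- Each `𝓛.L g` is an isometry with inverse `𝓛.L (Groupoid.inv g)`, which is therefore its adjoint.
omit [TopologicalSpace X] in
theorem inner_action (𝓛 : IsometricAction 𝕜 E) {x y : X} (g : x ⟶ y) (a : E y) (b : E x) :
    inner 𝕜 a (𝓛.L g b) = inner 𝕜 (𝓛.L (Groupoid.inv g) a) b := by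
  have h : a = 𝓛.L g (𝓛.L (Groupoid.inv g) a) := by
    rw [← 𝓛.map_comp, Groupoid.inv_comp, 𝓛.map_id]
  conv_lhs => rw [h]
  exact (𝓛.L g).inner_map_map _ _

omit [TopologicalSpace X] in
theorem tendsto_cocycle (κ : ContinuousCocycle 𝓛) (g : ArrowSpace X) :
    Filter.Tendsto (fun γ : ArrowSpace X => toBundle (κ.c γ.hom)) (𝓝 g)
      (𝓝 (toBundle (κ.c g.hom))) :=
  ((Pullback.continuous_lift Unit E (rangeMap : ArrowSpace X → X)).comp
    κ.continuous_section).tendsto g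

/-- Continuity of `γ ↦ L(γ)⁻¹ f(r(γ))`. -/
theorem tendsto_action_inv [IsTopologicalGroupoid X] (𝓛 : IsometricAction 𝕜 E) {f : ∀ x, E x}
    (g : ArrowSpace X)
    (hf : Filter.Tendsto (fun y => toBundle (f y)) (𝓝 g.right) (𝓝 (toBundle (f g.right)))) :
    Filter.Tendsto (fun γ : ArrowSpace X => toBundle (𝓛.L (Groupoid.inv γ.hom) (f γ.right))) (𝓝 g)
      (𝓝 (toBundle (𝓛.L (Groupoid.inv g.hom) (f g.right)))) := by
  let e (γ : ArrowSpace X) : BundleSpace ((sourceMap : ArrowSpace X → X) *ᵖ E) :=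
    ⟨⟨γ.right, γ.left, Groupoid.inv γ.hom⟩, f γ.right⟩
  have he : Filter.Tendsto e (𝓝 g) (𝓝 (e g)) := by
    rw [(inducing_pullbackTotalSpaceEmbedding Unit E
      (sourceMap : ArrowSpace X → X)).tendsto_nhds_iff]
    exact (IsTopologicalGroupoid.continuous_inv.tendsto g).prodMk_nhds
      (hf.comp (IsTopologicalGroupoid.continuous_range.tendsto g))
  exact (𝓛.continuous_action.tendsto (e g)).comp he

/-- If `γ₀u₀` has a weak neighbourhood `W`, the vectors `u` of norm at most `R` some translate of
which lies in `W` form a weak neighbourhood of `u₀` in the ball of radius `R`. -/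
theorem isWeakNhd_translate [LocallyCompactHausdorff X] [IsTopologicalGroupoid X]
    [IsHilbertBundle 𝕜 E] (κ : ContinuousCocycle 𝓛) {x₀ y₀ : X} (g₀ : x₀ ⟶ y₀) (u₀ : E x₀)
    {W : Set (BundleSpace E)} (hW : IsWeakNhd 𝕜 (toBundle (κ.affineAction g₀ u₀)) W) (R : ℝ) :
    IsWeakNhd 𝕜 (toBundle u₀) {q : BundleSpace E | ‖q.snd‖ ≤ R →
      ∃ (y : X) (g : q.proj ⟶ y), toBundle (κ.affineAction g q.snd) ∈ W} := by
  obtain ⟨V, hV, -, -, S, hS, hSc, ε, hε, hVW⟩ := hW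
  let γ₀ : ArrowSpace X := ⟨x₀, y₀, g₀⟩
  let T (f : ∀ x, E x) (γ : ArrowSpace X) : E γ.left := 𝓛.L (Groupoid.inv γ.hom) (f γ.right)
  -- Replacing `T f` by a section of the base costs at most `δ * |R|` at `u` and `δ * ‖u₀‖` at `u₀`.
  -- This is where boundedness enters.
  obtain ⟨δ, hδ, hδε⟩ : ∃ δ > 0, δ * (|R| + ‖u₀‖) ≤ ε / 4 := by
    refine ⟨ε / (4 * (|R| + ‖u₀‖ + 1)), by positivity, ?_⟩
    rw [div_mul_eq_mul_div, div_le_div_iff₀ (by positivity) (by norm_num)]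
    nlinarith [abs_nonneg R, norm_nonneg u₀]
  have hsec (f : ∀ x, E x) := exists_section_norm_sub_lt 𝕜 (T f γ₀) hδ
  choose U hU s hs hsT using hsec
  have hr : Filter.Tendsto rangeMap (𝓝 γ₀) (𝓝 y₀) :=
    IsTopologicalGroupoid.continuous_range.tendsto γ₀
  have hsrc : Filter.Tendsto sourceMap (𝓝 γ₀) (𝓝 x₀) :=
    IsTopologicalGroupoid.continuous_source.tendsto γ₀
  have hB : ∀ᶠ γ : ArrowSpace X in 𝓝 γ₀, rangeMap γ ∈ V ∧ ∀ f ∈ S,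
      ‖s f γ.left - T f γ‖ < δ ∧
        ‖(inner 𝕜 (f γ.right) (κ.c γ.hom) - inner 𝕜 (f y₀) (κ.c g₀) : 𝕜)‖ < ε / 4 := by
    refine (hr.eventually hV).and ((Filter.eventually_all_finite hS).mpr fun f hf => ?_)
    have hfc : Filter.Tendsto (fun y => toBundle (f y)) (𝓝 y₀) (𝓝 (toBundle (f y₀))) :=
      (hSc f hf).continuousAt hV
    have hsc : Filter.Tendsto (fun y => toBundle (s f y)) (𝓝 x₀) (𝓝 (toBundle (s f x₀))) :=
      (hs f).continuousAt (hU f)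
    have h₁ := tendsto_norm 𝕜 (tendsto_sub 𝕜 (hsc.comp hsrc) (tendsto_action_inv 𝓛 γ₀ hfc))
    have h₂ := tendsto_inner 𝕜 (hfc.comp hr) (tendsto_cocycle κ γ₀)
    exact (h₁.eventually_lt_const (hsT f)).and
      ((tendsto_sub_nhds_zero_iff.mpr h₂).norm.eventually_lt_const (by simpa using hε))
  obtain ⟨K, hK, hKc, hKt⟩ := LocallyCompactHausdorff.exists_nhd x₀
  -- Since the source map is open, every point of `V'` is the source of an arrow satisfying the
  -- estimates `hB`.
  obtain ⟨V', hV', hVc', hVt', -, hVs⟩ := exists_compact_nhd_subset_inter hK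
    (Filter.inter_mem (IsTopologicalGroupoid.isOpenMap_source.image_mem_nhds hB)
      ((Filter.biInter_mem hS).mpr fun f _ => hU f)) hKc hKt
  refine ⟨V', hV', hVc', hVt', s '' S, hS.image s, ?_, ε / 4, by linarith, ?_⟩
  · rintro _ ⟨f, hf, rfl⟩
    exact (hs f).mono fun y hy => mem_iInter₂.mp (hVs hy).2 f hf
  rintro ⟨x, u⟩ ⟨hx, hu⟩ huR
  obtain ⟨⟨x', y, g⟩, ⟨hγV, hγ⟩, hxx⟩ := (hVs hx).1
  obtain rfl : x' = x := hxx
  refine ⟨y, g, hVW ⟨hγV, fun f hf => ?_⟩⟩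
  obtain ⟨h₁, h₂⟩ := hγ f hf
  have h₃ := hu (s f) (mem_image_of_mem s hf)
  dsimp only at huR h₁ h₂ h₃ ⊢
  have h₄ : ‖(inner 𝕜 (s f x' - T f ⟨x', y, g⟩) u : 𝕜)‖ ≤ δ * |R| :=
    (norm_inner_le_norm _ _).trans
      (mul_le_mul h₁.le (huR.trans (le_abs_self R)) (norm_nonneg _) hδ.le)
  have h₅ : ‖(inner 𝕜 (s f x₀ - T f γ₀) u₀ : 𝕜)‖ ≤ δ * ‖u₀‖ :=
    (norm_inner_le_norm _ _).trans (mul_le_mul_of_nonneg_right (hsT f).le (norm_nonneg _))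
  -- Moving the action onto the test vector splits the difference into a weak variation of `u`, two
  -- approximation errors and a variation of the cocycle term.
  have h₆ : (inner 𝕜 (f y) (κ.affineAction g u) -
      inner 𝕜 (f y₀) (κ.affineAction g₀ u₀) : 𝕜) =
      (inner 𝕜 (s f x') u - inner 𝕜 (s f x₀) u₀) - inner 𝕜 (s f x' - T f ⟨x', y, g⟩) u +
        inner 𝕜 (s f x₀ - T f γ₀) u₀ + (inner 𝕜 (f y) (κ.c g) - inner 𝕜 (f y₀) (κ.c g₀)) := by
    simp only [ContinuousCocycle.affineAction, inner_add_right, inner_action, inner_sub_left, T, γ₀]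
    ring
  rw [h₆]
  refine (norm_add_le _ _).trans_lt ?_
  have h₇ := norm_add_le ((inner 𝕜 (s f x') u - inner 𝕜 (s f x₀) u₀ : 𝕜) -
    inner 𝕜 (s f x' - T f ⟨x', y, g⟩) u) (inner 𝕜 (s f x₀ - T f γ₀) u₀)
  have h₈ := norm_sub_le (inner 𝕜 (s f x') u - inner 𝕜 (s f x₀) u₀ : 𝕜)
    (inner 𝕜 (s f x' - T f ⟨x', y, g⟩) u)
  linarith

omit [TopologicalSpace X] in
/-- The affine action preserves convex combinations. -/
theorem affineAction_convexCombination (κ : ContinuousCocycle 𝓛) {x y : X} (g : x ⟶ y)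
    (u v : E x) {a b : 𝕜} (hab : a + b = 1) :
    κ.affineAction g (a • u + b • v) = a • κ.affineAction g u + b • κ.affineAction g v := by
  have h : κ.c g = a • κ.c g + b • κ.c g := by rw [← add_smul, hab, one_smul]
  simp only [ContinuousCocycle.affineAction, map_add, map_smul, smul_add]
  conv_lhs => rw [h]
  abel

end Action

end HilbertBundle

/-! ### Invariance of the convex hull. -/

open HilbertBundle

theorem mainTheorem6 {𝕜 : Type*} [RCLike 𝕜]
    {X : Type u} [TopologicalSpace X] [LocallyCompactHausdorff X]
    [Groupoid.{v} X] [TopologicalSpace (ArrowSpace X)]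
    [IsTopologicalGroupoid X] [LocallyCompactHausdorff (ArrowSpace X)]
    {E : X → Type w} [∀ x, NormedAddCommGroup (E x)] [∀ x, InnerProductSpace 𝕜 (E x)]
    [TopologicalSpace (BundleSpace E)] [IsHilbertBundle 𝕜 E]
    (𝓛 : IsometricAction 𝕜 E) (κ : ContinuousCocycle 𝓛)
    (A : Set (BundleSpace E)) (hA : IsBundleBounded A) (hinv : κ.IsInvariant A) :
    κ.IsInvariant (bundleConvexHull 𝕜 A) := by
  obtain ⟨R, hR⟩ := hA
  obtain ⟨⟨hAC, hconv, hclosed⟩, hmin⟩ := isLeast_bundleConvexHull 𝕜 A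
  -- The norm bound is built in because translates are controlled weakly only on bounded sets.
  let C : Set (BundleSpace E) := {q | ‖q.snd‖ ≤ R ∧
    ∀ (y : X) (g : q.proj ⟶ y), toBundle (κ.affineAction g q.snd) ∈ bundleConvexHull 𝕜 A}
  have hC : bundleConvexHull 𝕜 A ⊆ C := by
    refine hmin ⟨fun q hq => ⟨hR q hq, fun y g => hAC (hinv g q.snd hq)⟩, ?_, ?_⟩
    · intro x
      let := InnerProductSpace.rclikeToReal 𝕜 (E x)
      intro u hu v hv a b ha hb hab
      refine ⟨?_, fun y g => ?_⟩
      · exact mem_closedBall_zero_iff.mp (convex_closedBall (0 : E x) R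
          (mem_closedBall_zero_iff.mpr hu.1) (mem_closedBall_zero_iff.mpr hv.1) ha hb hab)
      · have h := affineAction_convexCombination κ g u v (a := (a : 𝕜)) (b := (b : 𝕜))
          (by exact_mod_cast hab)
        change toBundle (κ.affineAction g ((a : 𝕜) • u + (b : 𝕜) • v)) ∈ _
        rw [h]
        exact hconv y (hu.2 y g) (hv.2 y g) ha hb hab
    · refine @IsClosed.mk _ (weakTopology 𝕜 E) _ ?_
      intro p hp
      rcases lt_or_ge R ‖p.snd‖ with hpR | hpR
      · obtain ⟨V, hV, hVc, hVt, S, hS, hSc, ε, hε, h⟩ := isWeakNhd_norm_gt 𝕜 hpR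
        exact ⟨V, hV, hVc, hVt, S, hS, hSc, ε, hε, h.trans fun q hq hqC => hq.not_ge hqC.1⟩
      · have hp' : ¬ ∀ (y : X) (g : p.proj ⟶ y),
            toBundle (κ.affineAction g p.snd) ∈ bundleConvexHull 𝕜 A := fun h => hp ⟨hpR, h⟩
        push Not at hp'
        obtain ⟨y, g, hg⟩ := hp'
        obtain ⟨V, hV, hVc, hVt, S, hS, hSc, ε, hε, h⟩ := isWeakNhd_translate κ g p.snd
          ((@IsClosed.isOpen_compl _ (weakTopology 𝕜 E) _ hclosed) _ hg) R
        refine ⟨V, hV, hVc, hVt, S, hS, hSc, ε, hε, h.trans fun q hq hqC => ?_⟩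
        obtain ⟨z, k, hk⟩ := hq hqC.1
        exact hk (hqC.2 z k)
  intro x y g u hu
  exact (hC hu).2 y g
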